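/- Let $\mathcal{L}^n$ be the algebraic variety of complex Lie algebra laws on $\mathbb{C}^n$ (a closed subset of the affine space $\mathbb{C}^{n^3}$ of structure constants), on which $GL(n,\mathbb{C})$ acts by $(f*\mu)(X,Y)=f^{-1}(\mu(f(X),f(Y)))$. An $n$-dimensional complex Lie algebra is called rigid if the $GL(n,\mathbb{C})$-orbit of its law is Zariski open in $\mathcal{L}^n$. A Lie algebra $\mathfrak{r}$ is called $2$-step solvable if it is solvable and not nilpotent, $D^{(2)}\mathfrak{r}=0$ and $D^{(1)}\mathfrak{r}\neq 0$, where $D^{(0)}\mathfrak{r}=\mathfrak{r}$ and $D^{(k+1)}\mathfrak{r}=[D^{(k)}\mathfrak{r},D^{(k)}\mathfrak{r}]$. A torus of derivations of a Lie algebra $\mathfrak{g}$ is an abelian subalgebra $T$ of $\mathrm{Der}(\mathfrak{g})$ consisting of semisimple endomorphisms. **Theorem 3.** Let $\mathfrak{g}$ be a finite-dimensional nonabelian nilpotent complex Lie algebra and let $T$ be a torus of derivations of $\mathfrak{g}$. Then a Lie algebra $\mathfrak{r}$ isomorphic to the semidirect product $\mathfrak{g}\oplus T$ is not both $2$-step solvable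 and rigid. In other words, there is no decomposable, $2$-step solvable, rigid Lie algebra $\mathfrak{r}=\mathfrak{g}\oplus T$ with $\mathfrak{g}$ nilpotent and nonabelian. -/

import Mathlib

noncomputable section

namespace LieRigidity

/-- Bilinear multiplications on `ℂⁿ`. -/
abbrev Mult (n : ℕ) : Type :=
  (Fin n → ℂ) →ₗ[ℂ] (Fin n → ℂ) →ₗ[ℂ] (Fin n → ℂ)

/-- The structure constants of a multiplication with respect to the canonical basis: these are the
coordinates of the affine space of multiplications. -/
def structConst {n : ℕ} (μ : Mult n) : Fin n × Fin n × Fin n → ℂ :=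
  fun i => μ (Pi.single i.1 1) (Pi.single i.2.1 1) i.2.2

/-- The variety of complex Lie algebra laws on `ℂⁿ`. -/
def lieLaws (n : ℕ) : Set (Mult n) :=
  {μ | (∀ x, μ x x = 0) ∧
    ∀ x y z, μ x (μ y z) + μ y (μ z x) + μ z (μ x y) = 0}

/-- The action of `GL(n, ℂ)` on multiplications, `(f * μ)(x, y) = f⁻¹ (μ (f x, f y))`. -/
def act {n : ℕ} (f : (Fin n → ℂ) ≃ₗ[ℂ] (Fin n → ℂ)) (μ : Mult n) : Mult n :=
  (μ.compl₁₂ f.toLinearMap f.toLinearMap).compr₂ f.symm.toLinearMap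

/-- The orbit of a multiplication under `GL(n, ℂ)`. -/
def orbit {n : ℕ} (μ : Mult n) : Set (Mult n) :=
  {ν | ∃ f : (Fin n → ℂ) ≃ₗ[ℂ] (Fin n → ℂ), ν = act f μ}

/-- `U` is a Zariski open subset of the variety of Lie algebra laws: the complement, in this
variety, of the zero locus of an ideal of polynomials in the structure constants. -/
def IsZariskiOpenInLaws {n : ℕ} (U : Set (Mult n)) : Prop :=
  ∃ I : Ideal (MvPolynomial (Fin n × Fin n × Fin n) ℂ),
    U = {μ | μ ∈ lieLaws n ∧ structConst μ ∉ MvPolynomial.zeroLocus ℂ I}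

/-- A Lie algebra law is rigid if its orbit is Zariski open in the variety of Lie algebra laws. -/
def IsRigidLaw {n : ℕ} (μ : Mult n) : Prop :=
  μ ∈ lieLaws n ∧ IsZariskiOpenInLaws (orbit μ)

section LieAlg

variable (L : Type*) [LieRing L] [LieAlgebra ℂ L]

variable {L} in
/-- The law of a Lie algebra with respect to a basis: its bracket, transported to `ℂⁿ`. -/
def lawOfBasis {n : ℕ} (b : Module.Basis (Fin n) ℂ L) : Mult n :=
  ((LieModule.toEnd ℂ L L : L →ₗ[ℂ] L →ₗ[ℂ] L).compl₁₂
    b.equivFun.symm.toLinearMap b.equivFun.symm.toLinearMap).compr₂ b.equivFun.toLinearMap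

/-- A finite-dimensional complex Lie algebra is rigid if its law (in some basis; the laws in the
various bases form one orbit) is rigid. -/
def IsRigid : Prop :=
  ∃ (n : ℕ) (b : Module.Basis (Fin n) ℂ L), IsRigidLaw (lawOfBasis b)

/-- `L` is `s`-step solvable: it is not nilpotent, and `s` is the first (positive) index at which
the derived series vanishes. -/
def IsStepSolvable (s : ℕ) : Prop :=
  ¬ LieRing.IsNilpotent L ∧
    LieAlgebra.derivedSeries ℂ L s = ⊥ ∧ LieAlgebra.derivedSeries ℂ L (s - 1) ≠ ⊥

variable {L} in
/-- A torus of derivations: an abelian subalgebra of `Der L` consisting of semisimple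
endomorphisms. -/
def IsTorus (T : LieSubalgebra ℂ (LieDerivation ℂ L L)) : Prop :=
  IsLieAbelian T ∧ ∀ D ∈ T, Module.End.IsSemisimple (D : L →ₗ[ℂ] L)

end LieAlg

end LieRigidity

end

namespace LieRigidity

/-! Write `𝔤 = 𝔤₀ ⊕ V`, with `𝔤₀` the zero weight space of `T` and `V = moved T`. As `V` lies in the
abelian derived algebra of the semidirect sum, it is an abelian ideal of `𝔤` that commutes with `[𝔤,
𝔤]`. If `𝔤₀ = 0`, then `𝔤 = V` is abelian; if `V = 0`, then `T = 0` and the sum is nilpotent. So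
both are nonzero.

A derivation `D` and a linear form `φ` killing brackets and the image of `D` give a line of Lie laws
`⁅x, y⁆ + t (φ x D y - φ y D x)`. Rigidity makes some law with `t ≠ 0` isomorphic to the original
one (`IsRigid.exists_equiv`). Three choices of `(D, φ)` give the contradiction.

(1) With `D` the projection onto `V` and `φ` a form on `𝔤₀`, comparing ad-nilpotent elements yields
`τ₀ ∈ T` acting as the identity on `V` (`exists_apply_eq_self`). (2) With `φ τ₀ = 1`, suitable
derivations commuting with `T` must be inner (`exists_eq_lie`). Hence `𝔤₀` acts faithfully on `V`
(`eq_zero_of_lie_moved`), and so is abelian. (3) A central weight vector `v` and a form `γ` of its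
weight (`exists_weight_form`) give derivations `γ ⁅a, ·⁆ v`, inner by (2), say equal to `ad (δ a)`.
Then `δ` on `𝔤₀` plus `γ(·) v` is a derivation whose deformation is not metabelian. -/

/-- Along an affine line of multiplications starting at a rigid law, some law other than the
starting point lies in the orbit, provided that the line consists of Lie algebra laws. -/
theorem IsRigidLaw.exists_mem_orbit {n : ℕ} {μ : Mult n} (hμ : IsRigidLaw μ) (ν : Mult n)
    (h : ∀ t : ℂ, μ + t • ν ∈ lieLaws n) : ∃ t : ℂ, t ≠ 0 ∧ μ + t • ν ∈ orbit μ := by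
  obtain ⟨-, I, hI⟩ := hμ
  have hmem : μ ∈ orbit μ := ⟨LinearEquiv.refl ℂ _, by ext; simp [act]⟩
  rw [hI] at hmem
  obtain ⟨p, hpI, hp⟩ : ∃ p ∈ I, MvPolynomial.aeval (structConst μ) p ≠ 0 := by
    simpa [MvPolynomial.mem_zeroLocus_iff] using hmem.2
  set q : Polynomial ℂ := MvPolynomial.aeval
    (fun i => Polynomial.C (structConst μ i) + Polynomial.X * Polynomial.C (structConst ν i)) p
    with hq
  have heval (t : ℂ) : q.eval t = MvPolynomial.aeval (structConst (μ + t • ν)) p := by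
    rw [hq, ← Polynomial.coe_evalRingHom, MvPolynomial.aeval_def, MvPolynomial.hom_eval₂,
      MvPolynomial.aeval_def]
    congr 1
    · ext; simp
    · ext i; simpa [structConst] using mul_comm _ _
  -- The factor `X` forces the nonroot `t` found below to be nonzero.
  have hq0 : q * Polynomial.X ≠ 0 := by
    refine mul_ne_zero (fun h0 => hp ?_) Polynomial.X_ne_zero
    simpa [h0] using (heval 0).symm
  obtain ⟨t, ht⟩ : ∃ t : ℂ, (q * Polynomial.X).eval t ≠ 0 := by
    by_contra! hall
    exact hq0 (Polynomial.funext fun t => by simpa using hall t)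
  rw [Polynomial.eval_mul, Polynomial.eval_X] at ht
  refine ⟨t, right_ne_zero_of_mul ht, ?_⟩
  rw [hI]
  exact ⟨h t, fun hz => left_ne_zero_of_mul ht ((heval t).trans (hz p hpI))⟩

/-! ### Linear deformations attached to a derivation and a linear form -/

section Deformation

variable {L : Type*} [LieRing L] [LieAlgebra ℂ L]

/-- The bilinear map `(x, y) ↦ φ x • D y - φ y • D x`. -/
def wedge (φ : L →ₗ[ℂ] ℂ) (D : L →ₗ[ℂ] L) : L →ₗ[ℂ] L →ₗ[ℂ] L :=
  LinearMap.mk₂ ℂ (fun x y => φ x • D y - φ y • D x)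
    (fun x y z => by simp only [map_add]; module) (fun c x y => by simp only [map_smul]; module)
    (fun x y z => by simp only [map_add]; module) (fun c x y => by simp only [map_smul]; module)

theorem wedge_apply (φ : L →ₗ[ℂ] ℂ) (D : L →ₗ[ℂ] L) (x y : L) :
    wedge φ D x y = φ x • D y - φ y • D x := rfl

/-- The terms linear in `t` cancel by the Leibniz rule, and the surviving quadratic ones, `φ x φ y
D² z` and the like, cancel in pairs. -/
theorem lie_add_wedge_jacobi {φ : L →ₗ[ℂ] ℂ} {D : L →ₗ[ℂ] L}
    (hD : ∀ x y, D ⁅x, y⁆ = ⁅D x, y⁆ + ⁅x, D y⁆) (hφD : ∀ x, φ (D x) = 0)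
    (hφ : ∀ x y : L, φ ⁅x, y⁆ = 0) (t : ℂ) {B : L → L → L}
    (hB : ∀ x y, B x y = ⁅x, y⁆ + t • (φ x • D y - φ y • D x)) (x y z : L) :
    B x (B y z) + B y (B z x) + B z (B x y) = 0 := by
  have key : ⁅x, ⁅y, z⁆⁆ + ⁅y, ⁅z, x⁆⁆ + ⁅z, ⁅x, y⁆⁆ = 0 := lie_jacobi x y z
  have e1 : ⁅D x, y⁆ = -⁅y, D x⁆ := (lie_skew _ _).symm
  have e2 : ⁅D y, z⁆ = -⁅z, D y⁆ := (lie_skew _ _).symm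
  have e3 : ⁅D z, x⁆ = -⁅x, D z⁆ := (lie_skew _ _).symm
  simp only [hB, map_add, map_sub, map_smul, hφD, hφ, hD, lie_add, lie_sub, lie_smul, smul_eq_mul,
    mul_zero, sub_zero, add_zero, zero_smul, e1, e2, e3]
  refine Eq.trans ?_ key
  module

/-- A rigid Lie algebra is isomorphic to some nontrivial member of the family
`⁅x, y⁆ + t • (φ x • D y - φ y • D x)`, for `D` a derivation. -/
theorem IsRigid.exists_equiv (h : IsRigid L) {φ : L →ₗ[ℂ] ℂ} {D : L →ₗ[ℂ] L}
    (hD : ∀ x y, D ⁅x, y⁆ = ⁅D x, y⁆ + ⁅x, D y⁆) (hφD : ∀ x, φ (D x) = 0)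
    (hφ : ∀ x y : L, φ ⁅x, y⁆ = 0) :
    ∃ t : ℂ, t ≠ 0 ∧ ∃ f : L ≃ₗ[ℂ] L,
      ∀ x y, f (⁅x, y⁆ + t • (φ x • D y - φ y • D x)) = ⁅f x, f y⁆ := by
  obtain ⟨n, b, hb⟩ := h
  set e := b.equivFun
  let ν : Mult n := ((wedge φ D).compl₁₂ e.symm.toLinearMap e.symm.toLinearMap).compr₂
    e.toLinearMap
  have hlaw (x y) : lawOfBasis b x y = e ⁅e.symm x, e.symm y⁆ := rfl
  have hsum (t : ℂ) (x y) : (lawOfBasis b + t • ν) x y =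
      e (⁅e.symm x, e.symm y⁆ + t • wedge φ D (e.symm x) (e.symm y)) := by
    rw [map_add, map_smul]; rfl
  obtain ⟨t, ht, f, hf⟩ := hb.exists_mem_orbit ν fun t => by
    refine ⟨fun x => ?_, fun x y z => ?_⟩
    · rw [hsum]; simp [wedge_apply]
    · simp only [hsum, e.symm_apply_apply, ← map_add]
      rw [map_eq_zero_iff _ e.injective]
      exact lie_add_wedge_jacobi hD hφD hφ t (B := fun x y => ⁅x, y⁆ + t • wedge φ D x y)
        (fun _ _ => rfl) _ _ _
  refine ⟨t, ht, (e.trans f).trans e.symm, fun x y => ?_⟩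
  have := congrArg f (LinearMap.congr_fun₂ hf (e x) (e y))
  rw [hsum] at this
  simp only [act, LinearMap.compr₂_apply, LinearMap.compl₁₂_apply, hlaw,
    LinearEquiv.coe_coe, LinearEquiv.apply_symm_apply, LinearEquiv.symm_apply_apply] at this
  simp only [LinearEquiv.trans_apply]
  rw [LinearEquiv.symm_apply_eq, ← this, wedge_apply]

theorem IsRigid.of_equiv {L' : Type*} [LieRing L'] [LieAlgebra ℂ L'] (e : L ≃ₗ⁅ℂ⁆ L')
    (h : IsRigid L) : IsRigid L' := by
  obtain ⟨n, b, hb⟩ := h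
  refine ⟨n, b.map e.toLinearEquiv, ?_⟩
  convert hb using 1
  ext i j k
  simpa [lawOfBasis, ← LieEquiv.map_lie] using
    congrArg (fun v => b.repr v k) (e.toLinearEquiv.symm_apply_apply _)

end Deformation

/-! ### Weight decomposition under the torus -/

section Torus

variable {𝔤 : Type*} [LieRing 𝔤] [LieAlgebra ℂ 𝔤] (T : LieSubalgebra ℂ (LieDerivation ℂ 𝔤 𝔤))

/-- The joint eigenspace of a family of derivations, for a family of eigenvalues. -/
def weightSpace (χ : T → ℂ) : Submodule ℂ 𝔤 :=
  ⨅ τ : T, Module.End.eigenspace (τ.1 : 𝔤 →ₗ[ℂ] 𝔤) (χ τ)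

/-- The sum of the joint eigenspaces of nonzero weight. -/
def moved : Submodule ℂ 𝔤 := ⨆ χ ≠ 0, weightSpace T χ

variable {T}

theorem mem_weightSpace {χ : T → ℂ} {x : 𝔤} :
    x ∈ weightSpace T χ ↔ ∀ τ : T, τ.1 x = χ τ • x := by
  simp [weightSpace]

theorem mem_weightSpace_zero {x : 𝔤} : x ∈ weightSpace T 0 ↔ ∀ τ : T, τ.1 x = 0 := by
  simp [mem_weightSpace]

theorem weightSpace_le_moved {χ : T → ℂ} (h : χ ≠ 0) : weightSpace T χ ≤ moved T :=
  le_iSup₂_of_le χ h le_rfl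

theorem apply_mem_weightSpace {χ : T → ℂ} {x : 𝔤} (hx : x ∈ weightSpace T χ) (τ : T) :
    τ.1 x ∈ weightSpace T χ := by
  rw [mem_weightSpace.1 hx]
  exact Submodule.smul_mem _ _ hx

theorem moved_induction {p : 𝔤 → Prop} (h0 : p 0) (hadd : ∀ x y, p x → p y → p (x + y))
    (h : ∀ χ : T → ℂ, χ ≠ 0 → ∀ x ∈ weightSpace T χ, p x) {x : 𝔤} (hx : x ∈ moved T) : p x := by
  rw [moved, iSup_subtype'] at hx
  exact Submodule.iSup_induction _ (motive := p) hx (fun i x hx => h i.1 i.2 x hx) h0 hadd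

/-- A vector of nonzero weight is the image under some `τ` of a multiple of itself. -/
theorem moved_induction_apply {p : 𝔤 → Prop} (h0 : p 0) (hadd : ∀ x y, p x → p y → p (x + y))
    (h : ∀ (τ : T) (x : 𝔤), p (τ.1 x)) {x : 𝔤} (hx : x ∈ moved T) : p x := by
  refine moved_induction h0 hadd (fun χ hχ x hx => ?_) hx
  obtain ⟨τ, hτ⟩ := Function.ne_iff.1 hχ
  have := h τ ((χ τ)⁻¹ • x)
  rwa [map_smul, mem_weightSpace.1 hx, smul_smul, inv_mul_cancel₀ hτ, one_smul] at this

theorem apply_mem_moved {x : 𝔤} (hx : x ∈ moved T) (τ : T) : τ.1 x ∈ moved T :=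
  moved_induction (by simp) (fun x y hx hy => by rw [map_add]; exact add_mem hx hy)
    (fun _ hχ _ hx => weightSpace_le_moved hχ (apply_mem_weightSpace hx τ)) hx

theorem lie_mem_weightSpace {χ : T → ℂ} {x y : 𝔤} (hx : x ∈ weightSpace T 0)
    (hy : y ∈ weightSpace T χ) : ⁅x, y⁆ ∈ weightSpace T χ := by
  rw [mem_weightSpace] at *
  intro τ
  simp [hx, hy]

theorem lie_mem_moved {x y : 𝔤} (hx : x ∈ weightSpace T 0) (hy : y ∈ moved T) :
    ⁅x, y⁆ ∈ moved T :=
  moved_induction (by simp) (fun _ _ h h' => by rw [lie_add]; exact add_mem h h')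
    (fun _ hχ _ h => weightSpace_le_moved hχ (lie_mem_weightSpace hx h)) hy

/-- An element of the torus which differs from a scalar by a nilpotent on `moved T` is a scalar
there. -/
theorem apply_eq_smul_of_isNilpotent {τ : T} {c : ℂ} {B : Module.End ℂ (moved T)}
    (hB : IsNilpotent B) (h : ∀ v : moved T, τ.1 v.1 = c • v.1 + B v) {v : 𝔤} (hv : v ∈ moved T) :
    τ.1 v = c • v := by
  refine moved_induction (p := fun v => τ.1 v = c • v) (by simp)
    (fun x y hx hy => by rw [map_add, hx, hy, smul_add]) (fun χ hχ x hx => ?_) hv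
  obtain ⟨k, hk⟩ := hB
  let w : moved T := ⟨x, weightSpace_le_moved hχ hx⟩
  have hw : B w = (χ τ - c) • w := by
    apply Subtype.ext
    rw [Submodule.coe_smul, sub_smul, eq_sub_iff_add_eq', ← h w]
    exact mem_weightSpace.1 hx τ
  have hpow (n : ℕ) : (B ^ n) w = (χ τ - c) ^ n • w := by
    induction n with
    | zero => simp
    | succ n ih => rw [pow_succ', Module.End.mul_apply, ih, map_smul, hw, pow_succ, mul_smul]
  have h0 := hpow k
  rw [hk, LinearMap.zero_apply] at h0
  rcases smul_eq_zero.1 h0.symm with h1 | h1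
  · rw [mem_weightSpace.1 hx τ, sub_eq_zero.1 (eq_zero_of_pow_eq_zero h1)]
  · have hx0 : x = 0 := congrArg Subtype.val h1
    simp [hx0]

theorem IsTorus.apply_comm (hT : IsTorus T) (σ τ : T) (x : 𝔤) : σ.1 (τ.1 x) = τ.1 (σ.1 x) := by
  have := hT.1
  have h : ⁅σ, τ⁆ = 0 := trivial_lie_zero _ _ σ τ
  have h' := congrArg (fun D : T => D.1 x) h
  simpa [LieDerivation.commutator_apply, sub_eq_zero] using h'

/-- Semisimplicity is used only here: it reduces the decomposition to that of a commuting family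
into generalized eigenspaces. -/
theorem IsTorus.weightSpace_eq [FiniteDimensional ℂ 𝔤] (hT : IsTorus T) (χ : T → ℂ) :
    weightSpace T χ = ⨅ τ : T, Module.End.maxGenEigenspace (τ.1 : 𝔤 →ₗ[ℂ] 𝔤) (χ τ) := by
  refine iInf_congr fun τ => ?_
  exact ((hT.2 τ.1 τ.2).isFinitelySemisimple.maxGenEigenspace_eq_eigenspace _).symm

theorem IsTorus.commute (hT : IsTorus T) (σ τ : T) :
    Commute (σ.1 : Module.End ℂ 𝔤) (τ.1 : Module.End ℂ 𝔤) :=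
  LinearMap.ext fun x => hT.apply_comm σ τ x

theorem IsTorus.iSup_weightSpace [FiniteDimensional ℂ 𝔤] (hT : IsTorus T) :
    ⨆ χ, weightSpace T χ = ⊤ := by
  simp_rw [hT.weightSpace_eq]
  refine Module.End.iSup_iInf_maxGenEigenspace_eq_top_of_iSup_maxGenEigenspace_eq_top_of_commute
    (fun τ : T => (τ.1 : Module.End ℂ 𝔤)) (fun σ τ _ => hT.commute σ τ) fun τ => ?_
  exact Module.End.iSup_maxGenEigenspace_eq_top _

theorem IsTorus.iSupIndep_weightSpace [FiniteDimensional ℂ 𝔤] (hT : IsTorus T) :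
    iSupIndep (weightSpace T) := by
  rw [funext hT.weightSpace_eq]
  exact Module.End.independent_iInf_maxGenEigenspace_of_forall_mapsTo
    (fun τ : T => (τ.1 : Module.End ℂ 𝔤)) fun σ τ _ =>
      Module.End.mapsTo_maxGenEigenspace_of_comm (hT.commute τ σ) _

theorem IsTorus.isCompl [FiniteDimensional ℂ 𝔤] (hT : IsTorus T) :
    IsCompl (weightSpace T 0) (moved T) := by
  refine ⟨hT.iSupIndep_weightSpace 0, codisjoint_iff.2 ?_⟩
  rw [moved, ← iSup_split_single, hT.iSup_weightSpace]

theorem IsTorus.exists_add [FiniteDimensional ℂ 𝔤] (hT : IsTorus T) (x : 𝔤) :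
    ∃ a ∈ weightSpace T 0, ∃ v ∈ moved T, a + v = x :=
  Submodule.mem_sup.1 (hT.isCompl.sup_eq_top ▸ Submodule.mem_top)

theorem IsTorus.eq_zero_of_apply [FiniteDimensional ℂ 𝔤] (hT : IsTorus T) {τ : T}
    (h : ∀ v ∈ moved T, τ.1 v = 0) : τ = 0 := by
  ext x
  obtain ⟨a, ha, v, hv, rfl⟩ := hT.exists_add x
  simp [h v hv, mem_weightSpace_zero.1 ha]

theorem IsTorus.apply_mem_moved [FiniteDimensional ℂ 𝔤] (hT : IsTorus T) (τ : T) (x : 𝔤) :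
    τ.1 x ∈ moved T := by
  obtain ⟨a, ha, v, hv, rfl⟩ := hT.exists_add x
  rw [map_add, mem_weightSpace_zero.1 ha, zero_add]
  exact LieRigidity.apply_mem_moved hv τ

end Torus

/-! ### Two facts on nilpotent Lie algebras -/

section Nilpotent

variable {𝔤 : Type*} [LieRing 𝔤] [LieAlgebra ℂ 𝔤]

/-- In a nilpotent Lie algebra, a subspace contained in the span of its brackets with the whole
algebra is zero. -/
theorem eq_bot_of_le_span_lie (hnil : LieRing.IsNilpotent 𝔤) {Y : Submodule ℂ 𝔤}
    (h : ∀ y ∈ Y, y ∈ Submodule.span ℂ {z | ∃ x : 𝔤, ∃ y' ∈ Y, ⁅x, y'⁆ = z}) : Y = ⊥ := by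
  have hle (k : ℕ) : Y ≤ (LieModule.lowerCentralSeries ℂ 𝔤 𝔤 k).toSubmodule := by
    induction k with
    | zero => simp
    | succ k ih =>
      intro y hy
      refine Submodule.span_le.2 ?_ (h y hy)
      rintro _ ⟨x, y', hy', rfl⟩
      rw [LieModule.lowerCentralSeries_succ]
      exact LieSubmodule.lie_mem_lie (LieSubmodule.mem_top x) (ih hy')
  obtain ⟨k, hk⟩ := LieModule.IsNilpotent.nilpotent ℂ 𝔤 𝔤
  exact le_bot_iff.1 ((hle k).trans (by rw [hk]; simp))

/-- A nonzero ideal of a nilpotent Lie algebra contains a nonzero central element. -/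
theorem exists_central_mem (hnil : LieRing.IsNilpotent 𝔤) {Y : Submodule ℂ 𝔤} (hY : Y ≠ ⊥)
    (h : ∀ x : 𝔤, ∀ y ∈ Y, ⁅x, y⁆ ∈ Y) : ∃ y ∈ Y, y ≠ 0 ∧ ∀ x : 𝔤, ⁅x, y⁆ = 0 := by
  let N : LieSubmodule ℂ 𝔤 𝔤 := { Y with lie_mem := fun {x y} hy => h x y hy }
  have hN : Nontrivial N := Submodule.nontrivial_iff_ne_bot.2 hY
  have : LieModule.IsNilpotent 𝔤 N :=
    Function.Injective.lieModuleIsNilpotent (R := ℂ) (f := LieHom.id) (g := N.incl.toLinearMap)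
      (fun x m => rfl) N.injective_incl
  have := LieModule.nontrivial_max_triv_of_isNilpotent ℂ 𝔤 N
  obtain ⟨y, hy⟩ := exists_ne (0 : LieModule.maxTrivSubmodule ℂ 𝔤 N)
  refine ⟨y.1.1, y.1.2, fun h0 => hy (Subtype.ext (Subtype.ext h0)), fun x => ?_⟩
  exact congrArg Subtype.val (y.2 x)

end Nilpotent

/-! ### Metabelian semidirect sums and their deformations -/

section SemiDirect

variable {𝔤 : Type*} [LieRing 𝔤] [LieAlgebra ℂ 𝔤] {T : LieSubalgebra ℂ (LieDerivation ℂ 𝔤 𝔤)}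

/-- `T` acts on `𝔤` in such a way that the semidirect sum is metabelian. -/
structure IsMetabelianAction (T : LieSubalgebra ℂ (LieDerivation ℂ 𝔤 𝔤)) : Prop where
  lie_moved : ∀ v ∈ moved T, ∀ w ∈ moved T, ⁅v, w⁆ = 0
  lie_lie_moved : ∀ x y : 𝔤, ∀ v ∈ moved T, ⁅⁅x, y⁆, v⁆ = 0

theorem lie_mk (x y : 𝔤) (σ τ : T) :
    ⁅(⟨x, σ⟩ : LieAlgebra.SemiDirectSum 𝔤 T T.incl),
      (⟨y, τ⟩ : LieAlgebra.SemiDirectSum 𝔤 T T.incl)⁆ =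
      ⟨⁅x, y⁆ + σ.1 y - τ.1 x, ⁅σ, τ⁆⟩ := rfl

theorem isMetabelianAction_of_lie
    (h : ∀ a b c d : LieAlgebra.SemiDirectSum 𝔤 T T.incl, ⁅⁅a, b⁆, ⁅c, d⁆⁆ = 0) :
    IsMetabelianAction T := by
  have h1 (τ σ : T) (x y : 𝔤) : ⁅τ.1 x, σ.1 y⁆ = 0 := by
    have := congrArg (·.left) (h ⟨0, τ⟩ ⟨x, 0⟩ ⟨0, σ⟩ ⟨y, 0⟩)
    simpa [lie_mk] using this
  have h2 (σ : T) (x y z : 𝔤) : ⁅⁅x, y⁆, σ.1 z⁆ = 0 := by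
    have := congrArg (·.left) (h ⟨x, 0⟩ ⟨y, 0⟩ ⟨0, σ⟩ ⟨z, 0⟩)
    simpa [lie_mk] using this
  constructor
  · intro v hv w hw
    refine moved_induction_apply (p := fun v => ⁅v, w⁆ = 0) (by simp)
      (fun x y hx hy => by rw [add_lie, hx, hy, add_zero]) (fun τ x => ?_) hv
    exact moved_induction_apply (p := fun w => ⁅τ.1 x, w⁆ = 0) (by simp)
      (fun x y hx hy => by rw [lie_add, hx, hy, add_zero]) (fun σ y => h1 τ σ x y) hw
  · intro x y v hv
    exact moved_induction_apply (p := fun v => ⁅⁅x, y⁆, v⁆ = 0) (by simp)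
      (fun x y hx hy => by rw [lie_add, hx, hy, add_zero]) (fun σ z => h2 σ x y z) hv

/-- The bracket of the deformed semidirect sum, as an element of `𝔤`. -/
def deformedLie (d : 𝔤 →ₗ[ℂ] 𝔤) (ξ : 𝔤 →ₗ[ℂ] ℂ) (φ : T →ₗ[ℂ] ℂ) (t : ℂ) (x : 𝔤) (σ : T) (y : 𝔤)
    (τ : T) : 𝔤 :=
  ⁅x, y⁆ + σ.1 y - τ.1 x + t • ((ξ x + φ σ) • d y - (ξ y + φ τ) • d x)

/-- The deforming derivation is `d` extended by zero on `T`, a derivation because `d` commutes with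
`T`; the form is `ξ + φ`. -/
theorem IsRigid.exists_semiDirectSum_equiv (hT : IsTorus T)
    (h : IsRigid (LieAlgebra.SemiDirectSum 𝔤 T T.incl)) {d : 𝔤 →ₗ[ℂ] 𝔤}
    (hd : ∀ x y, d ⁅x, y⁆ = ⁅d x, y⁆ + ⁅x, d y⁆) (hdT : ∀ (τ : T) x, d (τ.1 x) = τ.1 (d x))
    {ξ : 𝔤 →ₗ[ℂ] ℂ} (hξ : ∀ x y : 𝔤, ξ ⁅x, y⁆ = 0) (hξT : ∀ (τ : T) x, ξ (τ.1 x) = 0)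
    (hξd : ∀ x, ξ (d x) = 0) (φ : T →ₗ[ℂ] ℂ) :
    ∃ t : ℂ, t ≠ 0 ∧ ∃ f : LieAlgebra.SemiDirectSum 𝔤 T T.incl ≃ₗ[ℂ]
      LieAlgebra.SemiDirectSum 𝔤 T T.incl,
      ∀ x σ y τ, f ⟨deformedLie d ξ φ t x σ y τ, 0⟩ = ⁅f ⟨x, σ⟩, f ⟨y, τ⟩⁆ := by
  have hab := hT.1
  have hlie (σ τ : T) : ⁅σ, τ⁆ = 0 := trivial_lie_zero _ _ σ τ
  obtain ⟨t, ht, f, hf⟩ := h.exists_equiv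
    (φ := ξ ∘ₗ LieAlgebra.SemiDirectSum.projl T.incl +
      φ ∘ₗ (LieAlgebra.SemiDirectSum.projr T.incl : _ →ₗ[ℂ] T))
    (D := (LieAlgebra.SemiDirectSum.inl T.incl : 𝔤 →ₗ[ℂ] _) ∘ₗ d ∘ₗ
      LieAlgebra.SemiDirectSum.projl T.incl)
    (fun x y => by
      obtain ⟨x, σ⟩ := x
      obtain ⟨y, τ⟩ := y
      simp [hd, hdT]
      abel)
    (fun x => by simp [hξd])
    (fun x y => by simp [hξ, hξT, hlie])
  refine ⟨t, ht, f, fun x σ y τ => ?_⟩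
  rw [← hf]
  congr 1
  simp [deformedLie, hlie]

end SemiDirect

/-! ### The projection onto the zero weight space -/

section SemiDirect

variable {𝔤 : Type*} [LieRing 𝔤] [LieAlgebra ℂ 𝔤] {T : LieSubalgebra ℂ (LieDerivation ℂ 𝔤 𝔤)}
  [FiniteDimensional ℂ 𝔤]

/-- The projection onto the zero weight space along the other weight spaces. -/
noncomputable def IsTorus.proj (hT : IsTorus T) : 𝔤 →ₗ[ℂ] 𝔤 :=
  (weightSpace T 0).projection (moved T) hT.isCompl

theorem IsTorus.proj_mem (hT : IsTorus T) (x : 𝔤) : hT.proj x ∈ weightSpace T 0 :=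
  Submodule.projection_apply_mem _ _

theorem IsTorus.proj_of_fixed (hT : IsTorus T) {x : 𝔤} (hx : x ∈ weightSpace T 0) :
    hT.proj x = x :=
  Submodule.projection_apply_of_mem_left _ hx

theorem IsTorus.proj_of_moved (hT : IsTorus T) {x : 𝔤} (hx : x ∈ moved T) : hT.proj x = 0 :=
  Submodule.projection_apply_of_mem_right _ hx

theorem IsTorus.sub_proj_mem (hT : IsTorus T) (x : 𝔤) : x - hT.proj x ∈ moved T := by
  obtain ⟨a, ha, v, hv, rfl⟩ := hT.exists_add x
  rwa [map_add, hT.proj_of_fixed ha, hT.proj_of_moved hv, add_zero, add_sub_cancel_left]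

theorem IsTorus.proj_eq_zero (hT : IsTorus T) {x : 𝔤} : hT.proj x = 0 ↔ x ∈ moved T :=
  ⟨fun h => by simpa [h] using hT.sub_proj_mem x, hT.proj_of_moved⟩

theorem IsMetabelianAction.lie_mem_moved (hM : IsMetabelianAction T) (hT : IsTorus T)
    (x : 𝔤) {v : 𝔤} (hv : v ∈ moved T) : ⁅x, v⁆ ∈ moved T := by
  obtain ⟨a, ha, w, hw, rfl⟩ := hT.exists_add x
  rw [add_lie, hM.lie_moved w hw v hv, add_zero]
  exact LieRigidity.lie_mem_moved ha hv

theorem IsMetabelianAction.proj_lie (hM : IsMetabelianAction T) (hT : IsTorus T) (x y : 𝔤) :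
    hT.proj ⁅x, y⁆ = ⁅hT.proj x, hT.proj y⁆ := by
  obtain ⟨a, ha, v, hv, rfl⟩ := hT.exists_add x
  obtain ⟨b, hb, w, hw, rfl⟩ := hT.exists_add y
  have h1 : hT.proj ⁅a, w⁆ = 0 := hT.proj_of_moved (hM.lie_mem_moved hT a hw)
  have h2 : hT.proj ⁅v, b⁆ = 0 := by
    rw [← lie_skew, map_neg, hT.proj_of_moved (hM.lie_mem_moved hT b hv), neg_zero]
  simp [hM.lie_moved v hv w hw, h1, h2, hT.proj_of_moved hv, hT.proj_of_moved hw,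
    hT.proj_of_fixed ha, hT.proj_of_fixed hb, hT.proj_of_fixed (lie_mem_weightSpace ha hb)]

/-- The adjoint action on `moved T`. -/
def IsMetabelianAction.adMoved (hM : IsMetabelianAction T) (hT : IsTorus T)
    (x : 𝔤) : Module.End ℂ (moved T) :=
  (LieAlgebra.ad ℂ 𝔤 x).restrict fun _ hv => hM.lie_mem_moved hT x hv

theorem IsMetabelianAction.isNilpotent_adMoved (hM : IsMetabelianAction T)
    (hnil : LieRing.IsNilpotent 𝔤) (hT : IsTorus T)
    (x : 𝔤) : IsNilpotent (hM.adMoved hT x) :=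
  Module.End.isNilpotent.restrict _ (LieModule.isNilpotent_toEnd_of_isNilpotent ℂ 𝔤 𝔤 x)

/-- If `V + [𝔤, 𝔤₀]` were everything, projecting to `𝔤₀` would give `𝔤₀ ⊆ [𝔤, 𝔤₀]`, impossible by
nilpotency. -/
theorem IsMetabelianAction.exists_functional (hM : IsMetabelianAction T)
    (hnil : LieRing.IsNilpotent 𝔤) (hT : IsTorus T)
    (h0 : weightSpace T 0 ≠ ⊥) :
    ∃ ξ : 𝔤 →ₗ[ℂ] ℂ, ξ ≠ 0 ∧ (∀ x y : 𝔤, ξ ⁅x, y⁆ = 0) ∧ ∀ v ∈ moved T, ξ v = 0 := by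
  set S : Submodule ℂ 𝔤 :=
    Submodule.span ℂ {z | ∃ x : 𝔤, ∃ y ∈ weightSpace T 0, ⁅x, y⁆ = z} with hS
  have hlt : moved T ⊔ S < ⊤ := by
    rw [lt_top_iff_ne_top]
    intro htop
    refine h0 (eq_bot_of_le_span_lie hnil fun a ha => ?_)
    obtain ⟨v, hv, s, hs, rfl⟩ := Submodule.mem_sup.1 (htop ▸ Submodule.mem_top (x := a))
    have hs' : hT.proj s ∈ S := by
      refine Submodule.span_le (p := S.comap hT.proj).2 ?_ hs
      rintro _ ⟨x, y, hy, rfl⟩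
      exact Submodule.subset_span ⟨hT.proj x, hT.proj y, hT.proj_mem y, (hM.proj_lie hT x y).symm⟩
    rwa [← hT.proj_of_fixed ha, map_add, hT.proj_of_moved hv, zero_add]
  obtain ⟨ξ, hξ, hmap⟩ := Submodule.exists_dual_map_eq_bot_of_lt_top hlt inferInstance
  have hzero (x) (hx : x ∈ moved T ⊔ S) : ξ x = 0 := by
    simpa [hmap] using Submodule.mem_map_of_mem (f := ξ) hx
  have hm (v) (hv : v ∈ moved T) : ξ v = 0 := hzero v (Submodule.mem_sup_left hv)
  refine ⟨ξ, hξ, fun x y => ?_, hm⟩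
  obtain ⟨b, hb, w, hw, rfl⟩ := hT.exists_add y
  rw [lie_add, map_add, hm _ (hM.lie_mem_moved hT x hw), add_zero]
  exact hzero _ (Submodule.mem_sup_right (Submodule.subset_span ⟨x, b, hb, rfl⟩))

end SemiDirect

/-! ### Consequences of rigidity -/

section SemiDirect

variable {𝔤 : Type*} [LieRing 𝔤] [LieAlgebra ℂ 𝔤] {T : LieSubalgebra ℂ (LieDerivation ℂ 𝔤 𝔤)}

theorem ad_pow_mk (z u : 𝔤) (n : ℕ) :
    ((LieAlgebra.ad ℂ (LieAlgebra.SemiDirectSum 𝔤 T T.incl) ⟨z, 0⟩) ^ n) ⟨u, 0⟩ =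
      ⟨((LieAlgebra.ad ℂ 𝔤 z) ^ n) u, 0⟩ := by
  induction n with
  | zero => rfl
  | succ n ih =>
    rw [pow_succ', pow_succ', Module.End.mul_apply, Module.End.mul_apply, ih, LieAlgebra.ad_apply,
      LieAlgebra.ad_apply, lie_mk]
    simp

theorem isNilpotent_ad_mk (hnil : LieRing.IsNilpotent 𝔤) (z : 𝔤) :
    IsNilpotent (LieAlgebra.ad ℂ (LieAlgebra.SemiDirectSum 𝔤 T T.incl) ⟨z, 0⟩) := by
  obtain ⟨k, hk⟩ := LieModule.isNilpotent_toEnd_of_isNilpotent ℂ 𝔤 𝔤 z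
  -- The extra application moves any element into `𝔤`, where `ad z` has exponent `k`.
  refine ⟨k + 1, LinearMap.ext fun w => ?_⟩
  obtain ⟨w, σ⟩ := w
  have h1 : LieAlgebra.ad ℂ (LieAlgebra.SemiDirectSum 𝔤 T T.incl) ⟨z, 0⟩ ⟨w, σ⟩ =
      ⟨⁅z, w⁆ - σ.1 z, 0⟩ := by
    rw [LieAlgebra.ad_apply, lie_mk]; simp
  rw [pow_succ, Module.End.mul_apply, h1, ad_pow_mk]
  change (⟨(LieModule.toEnd ℂ 𝔤 𝔤 z ^ k) _, 0⟩ : LieAlgebra.SemiDirectSum 𝔤 T T.incl) = _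
  rw [hk]
  rfl

theorem isNilpotent_of_conj {M N : Type*} [AddCommGroup M] [Module ℂ M] [AddCommGroup N]
    [Module ℂ N] {A : Module.End ℂ M} {B : Module.End ℂ N} {f : M →ₗ[ℂ] N}
    (hf : Function.Injective f) (h : ∀ x, f (A x) = B (f x)) (hB : IsNilpotent B) :
    IsNilpotent A := by
  obtain ⟨k, hk⟩ := hB
  have hpow (n : ℕ) (x : M) : f ((A ^ n) x) = (B ^ n) (f x) := by
    induction n with
    | zero => rfl
    | succ n ih => rw [pow_succ', pow_succ', Module.End.mul_apply, h, ih, Module.End.mul_apply]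
  exact ⟨k, LinearMap.ext fun x => hf (by simp [hpow, hk])⟩

variable [FiniteDimensional ℂ 𝔤]

/-- If the semidirect sum is rigid, then the torus contains an element acting as the identity on
all nonzero weight spaces: otherwise there is a deformation with a smaller nilradical. -/
theorem IsMetabelianAction.exists_apply_eq_self (hM : IsMetabelianAction T)
    (hnil : LieRing.IsNilpotent 𝔤) (hT : IsTorus T)
    (hrig : IsRigid (LieAlgebra.SemiDirectSum 𝔤 T T.incl)) (h0 : weightSpace T 0 ≠ ⊥) :
    ∃ τ₀ : T, ∀ v ∈ moved T, τ₀.1 v = v := by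
  obtain ⟨ξ, hξ0, hξ, hξV⟩ := hM.exists_functional hnil hT h0
  set d : 𝔤 →ₗ[ℂ] 𝔤 := LinearMap.id - hT.proj with hd_def
  have hd0 {a} (ha : a ∈ weightSpace T 0) : d a = 0 := by simp [hd_def, hT.proj_of_fixed ha]
  have hdV {v} (hv : v ∈ moved T) : d v = v := by simp [hd_def, hT.proj_of_moved hv]
  have hdmem (x) : d x ∈ moved T := hT.sub_proj_mem x
  have hd (x y) : d ⁅x, y⁆ = ⁅d x, y⁆ + ⁅x, d y⁆ := by
    have h1 : ⁅d x, d y⁆ = 0 := hM.lie_moved _ (hdmem x) _ (hdmem y)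
    simp only [hd_def, LinearMap.sub_apply, LinearMap.id_apply, hM.proj_lie hT, sub_lie,
      lie_sub] at h1 ⊢
    rw [← sub_eq_zero, ← neg_eq_zero]
    exact Eq.trans (by abel) h1
  have hdT (τ : T) (x) : d (τ.1 x) = τ.1 (d x) := by
    rw [hdV (hT.apply_mem_moved τ x)]
    simp [hd_def, mem_weightSpace_zero.1 (hT.proj_mem x) τ]
  obtain ⟨t, ht, f, hf⟩ := hrig.exists_semiDirectSum_equiv hT hd hdT hξ
    (fun τ x => hξV _ (hT.apply_mem_moved τ x)) (fun x => hξV _ (hdmem x)) 0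
  -- If `f` sends `(x, σ)` into `𝔤`, its deformed adjoint map `A = ad x + σ + t ξ(x)` on `V` is
  -- nilpotent. Removing the commuting nilpotent `ad x` leaves `σ + t ξ(x)` nilpotent and
  -- diagonalizable, hence zero.
  have key (x : 𝔤) (σ : T) (hx : (f ⟨x, σ⟩).right = 0) (v) (hv : v ∈ moved T) :
      σ.1 v = (-(t * ξ x)) • v := by
    have hcomm (w) (hw : w ∈ moved T) : σ.1 ⁅x, w⁆ = ⁅x, σ.1 w⁆ := by
      rw [LieDerivation.apply_lie_eq_add, hM.lie_moved _ (hT.apply_mem_moved σ x) w hw, add_zero]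
    let S : Module.End ℂ (moved T) :=
      (σ.1 : 𝔤 →ₗ[ℂ] 𝔤).restrict fun w _ => hT.apply_mem_moved σ w
    let N := hM.adMoved hT x
    let A : Module.End ℂ (moved T) := N + S + (t * ξ x) • 1
    have hNS : Commute N S := LinearMap.ext fun w => Subtype.ext (hcomm w.1 w.2).symm
    have hA : IsNilpotent A := by
      refine isNilpotent_of_conj (f := f.toLinearMap ∘ₗ
          (LieAlgebra.SemiDirectSum.inl T.incl : 𝔤 →ₗ[ℂ] _) ∘ₗ (moved T).subtype)
        (f.injective.comp ((LieAlgebra.SemiDirectSum.inl_injective _).comp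
          (Submodule.injective_subtype _))) (fun w => ?_)
        (isNilpotent_ad_mk hnil (f ⟨x, σ⟩).left)
      have he : (⟨(f ⟨x, σ⟩).left, 0⟩ : LieAlgebra.SemiDirectSum 𝔤 T T.incl) = f ⟨x, σ⟩ := by
        ext1 <;> simp [hx]
      rw [he]
      refine Eq.trans (congrArg f ?_) (hf x σ w.1 0)
      have : (A w).1 = ⁅x, w.1⁆ + σ.1 w.1 + (t * ξ x) • w.1 := rfl
      simp [this, deformedLie, hξV _ w.2, hdV w.2, mul_smul]
    have hcAN : Commute A N :=
      ((Commute.refl N).add_left hNS.symm).add_left ((Commute.one_left N).smul_left _)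
    refine apply_eq_smul_of_isNilpotent (hcAN.isNilpotent_sub hA
      (hM.isNilpotent_adMoved hnil hT x)) (fun w => ?_) hv
    change σ.1 w.1 = (-(t * ξ x)) • w.1 + ((⁅x, w.1⁆ + σ.1 w.1 + (t * ξ x) • w.1) - ⁅x, w.1⁆)
    module
  by_contra! hno
  -- Without `τ₀`, the preimage of `𝔤` under `f` would lie in `ker ξ ⊆ 𝔤`, which is too small.
  let Θ : 𝔤 →ₗ[ℂ] 𝔤 := LieAlgebra.SemiDirectSum.projl T.incl ∘ₗ f.symm.toLinearMap ∘ₗ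
    (LieAlgebra.SemiDirectSum.inl T.incl : 𝔤 →ₗ[ℂ] _)
  have hΘ (z : 𝔤) : ξ (Θ z) = 0 ∧ (f.symm ⟨z, 0⟩).right = 0 := by
    have hz : (f ⟨Θ z, (f.symm ⟨z, 0⟩).right⟩).right = 0 := by
      change (f (f.symm ⟨z, 0⟩)).right = 0
      rw [f.apply_symm_apply]
    have hz' := key _ _ hz
    have hξz : ξ (Θ z) = 0 := by
      by_contra hne
      obtain ⟨v, hv, hvne⟩ := hno ((-(t * ξ (Θ z)))⁻¹ • (f.symm ⟨z, 0⟩).right)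
      refine hvne ?_
      change (-(t * ξ (Θ z)))⁻¹ • (f.symm ⟨z, 0⟩).right.1 v = v
      rw [hz' v hv, smul_smul, inv_mul_cancel₀ (neg_ne_zero.2 (mul_ne_zero ht hne)), one_smul]
    exact ⟨hξz, hT.eq_zero_of_apply fun v hv => by simp [hz' v hv, hξz]⟩
  have hinj : Function.Injective Θ := by
    refine (injective_iff_map_eq_zero Θ).2 fun z hz => ?_
    have : f.symm ⟨z, 0⟩ = 0 := LieAlgebra.SemiDirectSum.ext hz (hΘ z).2
    exact congrArg (·.left) ((LinearEquiv.map_eq_zero_iff _).1 this)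
  refine hξ0 (LinearMap.ext fun x => ?_)
  obtain ⟨z, rfl⟩ := LinearMap.injective_iff_surjective.1 hinj x
  exact (hΘ z).1

/-- If the semidirect sum is rigid, then certain derivations commuting with the torus are inner:
otherwise there is a deformation without an element that splits off the nonzero weight spaces. -/
theorem IsMetabelianAction.exists_eq_lie (hM : IsMetabelianAction T)
    (hnil : LieRing.IsNilpotent 𝔤) (hT : IsTorus T)
    (hrig : IsRigid (LieAlgebra.SemiDirectSum 𝔤 T T.incl)) (hV : moved T ≠ ⊥) {τ₀ : T}
    (hτ₀ : ∀ v ∈ moved T, τ₀.1 v = v) {d : 𝔤 →ₗ[ℂ] 𝔤}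
    (hd : ∀ x y, d ⁅x, y⁆ = ⁅d x, y⁆ + ⁅x, d y⁆) (hdT : ∀ (τ : T) x, d (τ.1 x) = τ.1 (d x))
    (hdd : ∀ v ∈ moved T, d (d v) = 0) (hdV : ∀ x, ∀ v ∈ moved T, ⁅d x, v⁆ = 0) :
    ∃ y ∈ weightSpace T 0, ∀ x, d x = ⁅y, x⁆ := by
  have hlie (σ τ : T) : ⁅σ, τ⁆ = 0 := by have := hT.1; exact trivial_lie_zero _ _ σ τ
  have hτ₀0 : τ₀ ≠ 0 := by
    rintro rfl
    exact hV (eq_bot_iff.2 fun v hv => (hτ₀ v hv).symm)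
  obtain ⟨φ, hφ⟩ := Module.Projective.exists_dual_eq_one ℂ hτ₀0
  obtain ⟨t, ht, f, hf⟩ := hrig.exists_semiDirectSum_equiv hT hd hdT (ξ := 0) (by simp) (by simp)
    (by simp) φ
  have hdmem {v} (hv : v ∈ moved T) : d v ∈ moved T := by
    rw [← hτ₀ v hv, hdT]; exact hT.apply_mem_moved _ _
  have hd0 {x} (hx : x ∈ weightSpace T 0) : d x ∈ weightSpace T 0 :=
    mem_weightSpace_zero.2 fun τ => by rw [← hdT, mem_weightSpace_zero.1 hx, map_zero]
  have hfV {v} (hv : v ∈ moved T) : ∃ u ∈ moved T, f ⟨v, 0⟩ = ⁅f ⟨0, τ₀⟩, f ⟨u, 0⟩⁆ := by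
    -- On `V` the deformed action of `τ₀` is `1 + t d`, with inverse `1 - t d` since `d² = 0` there.
    refine ⟨v - t • d v, sub_mem hv (Submodule.smul_mem _ _ (hdmem hv)), ?_⟩
    rw [← hf]
    congr 2
    simp [deformedLie, hφ, hτ₀ v hv, hdd v hv, hτ₀ _ (hdmem hv)]
  have hright {v} (hv : v ∈ moved T) : (f ⟨v, 0⟩).right = 0 := by
    obtain ⟨u, -, h⟩ := hfV hv
    rw [h]
    exact hlie _ _
  let F : 𝔤 →ₗ[ℂ] 𝔤 := LieAlgebra.SemiDirectSum.projl T.incl ∘ₗ f.toLinearMap ∘ₗ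
    (LieAlgebra.SemiDirectSum.inl T.incl : 𝔤 →ₗ[ℂ] _)
  have hF {v} (hv : v ∈ moved T) : f ⟨v, 0⟩ = ⟨F v, 0⟩ :=
    LieAlgebra.SemiDirectSum.ext rfl (hright hv)
  -- The image of `f(V)` in `𝔤₀` is contained in its own brackets with `𝔤`; this gives `f(V) = V`.
  have hFbot : (moved T).map (hT.proj ∘ₗ F) = ⊥ := by
    refine eq_bot_of_le_span_lie hnil ?_
    rintro _ ⟨v, hv, rfl⟩
    obtain ⟨u, hu, h⟩ := hfV hv
    have hFv : F v = ⁅(f ⟨0, τ₀⟩).left, F u⁆ + (f ⟨0, τ₀⟩).right.1 (F u) := by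
      have := congrArg (·.left) h
      rw [hF hu] at this
      simpa [hF hv] using this
    refine Submodule.subset_span ⟨hT.proj (f ⟨0, τ₀⟩).left, _, ⟨u, hu, rfl⟩, ?_⟩
    simp only [LinearMap.comp_apply]
    rw [hFv, map_add, hT.proj_of_moved (hT.apply_mem_moved _ _), add_zero, hM.proj_lie hT]
  have hFmem {v} (hv : v ∈ moved T) : F v ∈ moved T := by
    rw [← hT.proj_eq_zero]
    exact (Submodule.eq_bot_iff _).1 hFbot _ ⟨v, hv, rfl⟩
  have hFsurj {w} (hw : w ∈ moved T) : ∃ v ∈ moved T, f ⟨v, 0⟩ = ⟨w, 0⟩ := by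
    have hinj : Function.Injective (F.restrict fun v hv => hFmem hv) := by
      refine (injective_iff_map_eq_zero _).2 fun v hv => ?_
      have h1 : F v.1 = 0 := congrArg Subtype.val hv
      have h2 : f ⟨v.1, 0⟩ = 0 := by rw [hF v.2, h1]; rfl
      exact Subtype.ext (congrArg (·.left) ((LinearEquiv.map_eq_zero_iff f).1 h2))
    obtain ⟨v, hv⟩ := LinearMap.injective_iff_surjective.1 hinj ⟨w, hw⟩
    refine ⟨v.1, v.2, ?_⟩
    rw [hF v.2]
    exact congrArg (fun a => (⟨a, 0⟩ : LieAlgebra.SemiDirectSum 𝔤 T T.incl))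
      (congrArg Subtype.val hv)
  -- The deformed adjoint map of the preimage of `τ₀` inherits from `τ₀` that it is the identity on
  -- `V` and maps `𝔤` into `V`.
  obtain ⟨⟨y, σ⟩, hy⟩ := f.surjective ⟨0, τ₀⟩
  have hact (x : 𝔤) : f ⟨⁅y, x⁆ + σ.1 x + (t * φ σ) • d x, 0⟩ = ⟨τ₀.1 (f ⟨x, 0⟩).left, 0⟩ := by
    have := hf y σ x 0
    rw [hy] at this
    simpa [deformedLie, hlie, mul_smul] using this
  have hactV {v} (hv : v ∈ moved T) : ⁅y, v⁆ + σ.1 v + (t * φ σ) • d v = v := by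
    have := hact v
    rw [hF hv, hτ₀ _ (hFmem hv), ← hF hv] at this
    exact congrArg (·.left) (f.injective this)
  have hactmem (x : 𝔤) : ⁅y, x⁆ + σ.1 x + (t * φ σ) • d x ∈ moved T := by
    obtain ⟨v, hv, h⟩ := hFsurj (hT.apply_mem_moved τ₀ (f ⟨x, 0⟩).left)
    rw [← hact x] at h
    have := congrArg (·.left) (f.injective h)
    simp only at this
    rwa [← this]
  -- On `V`, `σ` is the identity minus the sum of the commuting nilpotents `ad y` and `t φ(σ) d`.
  have hσ : σ = τ₀ := by
    let E : Module.End ℂ (moved T) := d.restrict fun v hv => hdmem hv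
    have hE : IsNilpotent E := ⟨2, LinearMap.ext fun v => Subtype.ext (hdd v.1 v.2)⟩
    have hcomm : Commute (hM.adMoved hT y) ((t * φ σ) • E) := by
      refine Commute.smul_right (LinearMap.ext fun v => Subtype.ext ?_) _
      change ⁅y, d v.1⁆ = d ⁅y, v.1⁆
      rw [hd, hdV y v.1 v.2, zero_add]
    have hnilp := (hcomm.isNilpotent_add (hM.isNilpotent_adMoved hnil hT y) (hE.smul _)).neg
    rw [← sub_eq_zero]
    refine hT.eq_zero_of_apply fun v hv => ?_
    have := apply_eq_smul_of_isNilpotent (τ := σ) (c := 1) hnilp (fun w => ?_) hv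
    · change σ.1 v - τ₀.1 v = 0
      rw [this, hτ₀ v hv, one_smul, sub_self]
    · change σ.1 w.1 = (1 : ℂ) • w.1 + -(⁅y, w.1⁆ + (t * φ σ) • d w.1)
      rw [one_smul]
      nth_rewrite 2 [← hactV w.2]
      abel
  subst hσ
  rw [hφ, mul_one] at hactV hactmem
  have hlin {x : 𝔤} (h : ⁅hT.proj y, x⁆ + t • d x = 0) : d x = ⁅-(t⁻¹ • hT.proj y), x⁆ := by
    rw [neg_lie, smul_lie, eq_neg_of_add_eq_zero_left h, smul_neg, neg_neg, smul_smul,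
      inv_mul_cancel₀ ht, one_smul]
  refine ⟨-(t⁻¹ • hT.proj y), neg_mem (Submodule.smul_mem _ _ (hT.proj_mem y)), fun x => ?_⟩
  obtain ⟨a, ha, v, hv, rfl⟩ := hT.exists_add x
  rw [map_add, lie_add]
  congr 1
  · apply hlin
    have := hT.proj_of_moved (hactmem a)
    rwa [mem_weightSpace_zero.1 ha, add_zero, map_add, map_smul, hM.proj_lie hT,
      hT.proj_of_fixed ha, hT.proj_of_fixed (hd0 ha)] at this
  · apply hlin
    have h1 := hactV hv
    have h2 := hM.lie_moved _ (hT.sub_proj_mem y) v hv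
    rw [sub_lie, sub_eq_zero] at h2
    rw [hτ₀ v hv, h2, add_right_comm, add_eq_right] at h1
    exact h1

/-- If the semidirect sum is rigid, then the zero weight space acts faithfully on the others. -/
theorem IsMetabelianAction.eq_zero_of_lie_moved (hM : IsMetabelianAction T)
    (hnil : LieRing.IsNilpotent 𝔤) (hT : IsTorus T)
    (hrig : IsRigid (LieAlgebra.SemiDirectSum 𝔤 T T.incl)) (hV : moved T ≠ ⊥) {τ₀ : T}
    (hτ₀ : ∀ v ∈ moved T, τ₀.1 v = v) {k : 𝔤} (hk : k ∈ weightSpace T 0)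
    (hkV : ∀ v ∈ moved T, ⁅k, v⁆ = 0) : k = 0 := by
  by_contra hk0
  have h0 : weightSpace T 0 ≠ ⊥ := fun h => hk0 ((Submodule.eq_bot_iff _).1 h k hk)
  obtain ⟨ξ, hξ0, hξ, hξV⟩ := hM.exists_functional hnil hT h0
  let K : Submodule ℂ 𝔤 :=
    { carrier := {x | x ∈ weightSpace T 0 ∧ ∀ v ∈ moved T, ⁅x, v⁆ = 0}
      zero_mem' := ⟨zero_mem _, by simp⟩
      add_mem' := fun {a b} ha hb => ⟨add_mem ha.1 hb.1, fun v hv => by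
        rw [add_lie, ha.2 v hv, hb.2 v hv, add_zero]⟩
      smul_mem' := fun c a ha => ⟨Submodule.smul_mem _ _ ha.1, fun v hv => by
        rw [smul_lie, ha.2 v hv, smul_zero]⟩ }
  let Q : Submodule ℂ 𝔤 :=
    { carrier := {x | x ∈ weightSpace T 0 ∧ ∀ y, ξ y = 0 → ⁅x, y⁆ = 0}
      zero_mem' := ⟨zero_mem _, by simp⟩
      add_mem' := fun {a b} ha hb => ⟨add_mem ha.1 hb.1, fun v hv => by
        rw [add_lie, ha.2 v hv, hb.2 v hv, add_zero]⟩
      smul_mem' := fun c a ha => ⟨Submodule.smul_mem _ _ ha.1, fun v hv => by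
        rw [smul_lie, ha.2 v hv, smul_zero]⟩ }
  obtain ⟨q, hqK, hq0, hq⟩ := exists_central_mem hnil (Y := K)
    (fun h => hk0 ((Submodule.eq_bot_iff K).1 h k ⟨hk, hkV⟩)) (fun x y hy => by
      obtain ⟨a, ha, v, hv, rfl⟩ := hT.exists_add x
      rw [add_lie, ← lie_skew v, hy.2 v hv, neg_zero, add_zero]
      exact ⟨lie_mem_weightSpace ha hy.1, hM.lie_lie_moved a y⟩)
  have hQ : Q ≠ ⊥ := fun h => hq0 ((Submodule.eq_bot_iff Q).1 h q
    ⟨hqK.1, fun y _ => by rw [← lie_skew, hq, neg_zero]⟩)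
  -- The derivation `ξ(·) z` will be `ad y` with `y` again in `Q`, which puts `z` in `[𝔤, Q]`,
  -- against this choice.
  obtain ⟨z, hzQ, hz⟩ : ∃ z ∈ Q, z ∉ Submodule.span ℂ {z | ∃ x : 𝔤, ∃ y ∈ Q, ⁅x, y⁆ = z} := by
    by_contra! h
    exact hQ (eq_bot_of_le_span_lie hnil h)
  have hzV (v) (hv : v ∈ moved T) : ⁅z, v⁆ = 0 := hzQ.2 v (hξV v hv)
  obtain ⟨y, hy, hyd⟩ := hM.exists_eq_lie hnil hT hrig hV hτ₀ (d := ξ.smulRight z)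
    (fun x y => by
      have h1 : ⁅z, ξ x • y - ξ y • x⁆ = 0 := hzQ.2 _ (by simp [mul_comm])
      rw [lie_sub, lie_smul, lie_smul] at h1
      simp only [LinearMap.smulRight_apply, hξ, zero_smul, smul_lie, lie_smul]
      rw [← lie_skew z x, smul_neg] at h1
      rw [← h1, sub_neg_eq_add])
    (fun τ x => by
      simp [hξV _ (hT.apply_mem_moved τ x), mem_weightSpace_zero.1 hzQ.1])
    (fun v hv => by simp [hξV v hv]) (fun x v hv => by simp [hzV v hv])
  obtain ⟨x, hx⟩ : ∃ x, ξ x ≠ 0 := by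
    by_contra! h
    exact hξ0 (LinearMap.ext h)
  refine hz ?_
  have hyx : z = (ξ x)⁻¹ • ⁅y, x⁆ := by
    rw [← hyd, LinearMap.smulRight_apply, smul_smul, inv_mul_cancel₀ hx, one_smul]
  rw [hyx, ← lie_skew]
  refine Submodule.smul_mem _ _ (neg_mem (Submodule.subset_span ⟨x, y, ⟨hy, fun w hw => ?_⟩, rfl⟩))
  rw [← hyd, LinearMap.smulRight_apply, hw, zero_smul]

/-! ### The final, non-metabelian deformation -/

/-- In a metabelian semidirect sum with faithful, abelian, nonzero zero weight space, there are a
weight vector `v` central in `𝔤` and a linear form `γ` of the same weight vanishing on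
triple brackets but not on the brackets of the zero weight space with the others. -/
theorem IsMetabelianAction.exists_weight_form (hM : IsMetabelianAction T)
    (hnil : LieRing.IsNilpotent 𝔤) (hT : IsTorus T) (h0 : weightSpace T 0 ≠ ⊥)
    (hfaith : ∀ k ∈ weightSpace T 0, (∀ v ∈ moved T, ⁅k, v⁆ = 0) → k = 0) :
    ∃ (χ : T → ℂ) (v : 𝔤) (γ : 𝔤 →ₗ[ℂ] ℂ), v ≠ 0 ∧ v ∈ moved T ∧ v ∈ weightSpace T χ ∧
      (∀ x : 𝔤, ⁅x, v⁆ = 0) ∧ (∀ (τ : T) x, γ (τ.1 x) = χ τ * γ x) ∧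
      (∀ x ∈ weightSpace T 0, γ x = 0) ∧ (∀ x y z : 𝔤, γ ⁅x, ⁅y, z⁆⁆ = 0) ∧
      ∃ w ∈ weightSpace T 0, ∃ u ∈ moved T, γ ⁅w, u⁆ ≠ 0 := by
  have habel {a b : 𝔤} (ha : a ∈ weightSpace T 0) (hb : b ∈ weightSpace T 0) : ⁅a, b⁆ = 0 :=
    hfaith _ (lie_mem_weightSpace ha hb) (hM.lie_lie_moved a b)
  obtain ⟨a, ha, ha0⟩ := Submodule.exists_mem_ne_zero_of_ne_bot h0
  obtain ⟨χ, hχ, u, hu, hau⟩ : ∃ χ : T → ℂ, χ ≠ 0 ∧ ∃ u ∈ weightSpace T χ, ⁅a, u⁆ ≠ 0 := by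
    by_contra! h
    exact ha0 (hfaith a ha fun v hv => moved_induction (p := fun v => ⁅a, v⁆ = 0) (by simp)
      (fun x y hx hy => by rw [lie_add, hx, hy, add_zero]) h hv)
  have hideal (ψ : T → ℂ) (hψ : ψ ≠ 0) (x y : 𝔤) (hy : y ∈ weightSpace T ψ) :
      ⁅x, y⁆ ∈ weightSpace T ψ := by
    obtain ⟨b, hb, v, hv, rfl⟩ := hT.exists_add x
    rw [add_lie, hM.lie_moved v hv y (weightSpace_le_moved hψ hy), add_zero]
    exact lie_mem_weightSpace hb hy
  obtain ⟨v, hvχ, hv0, hv⟩ := exists_central_mem hnil (Y := weightSpace T χ)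
    (fun h => hau (by rw [(Submodule.eq_bot_iff _).1 h u hu, lie_zero])) (hideal χ hχ)
  -- the first and second terms of the lower central series of the ideal `weightSpace T χ`
  let Y₁ : Submodule ℂ 𝔤 :=
    Submodule.span ℂ {z | ∃ x : 𝔤, ∃ y ∈ weightSpace T χ, ⁅x, y⁆ = z}
  let Y₂ : Submodule ℂ 𝔤 := Submodule.span ℂ {z | ∃ x : 𝔤, ∃ y ∈ Y₁, ⁅x, y⁆ = z}
  have hY₁ : Y₁ ≤ weightSpace T χ := Submodule.span_le.2 (by
    rintro _ ⟨x, y, hy, rfl⟩; exact hideal χ hχ x y hy)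
  have hY₂ : Y₂ ≤ weightSpace T χ := Submodule.span_le.2 (by
    rintro _ ⟨x, y, hy, rfl⟩; exact hideal χ hχ x y (hY₁ hy))
  obtain ⟨y, hyY, hyn⟩ : ∃ y ∈ Y₁, y ∉ Y₂ := by
    by_contra! h
    exact hau ((Submodule.eq_bot_iff _).1 (eq_bot_of_le_span_lie hnil h) _
      (Submodule.subset_span ⟨a, u, hu, rfl⟩))
  let C : Submodule ℂ 𝔤 := ⨆ ψ ≠ χ, weightSpace T ψ
  have hdisj : Disjoint (weightSpace T χ) C := hT.iSupIndep_weightSpace χ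
  have htop : weightSpace T χ ⊔ C = ⊤ := by
    rw [← hT.iSup_weightSpace]; exact (iSup_split_single _ _).symm
  have hynC : y ∉ C ⊔ Y₂ := by
    rintro h
    obtain ⟨c, hc, m, hm, rfl⟩ := Submodule.mem_sup.1 h
    have hcχ : c ∈ weightSpace T χ := by simpa using sub_mem (hY₁ hyY) (hY₂ hm)
    rw [Submodule.disjoint_def.1 hdisj c hcχ hc, zero_add] at hyn
    exact hyn hm
  -- Killing `C` gives `γ` the weight `χ`; killing `Y₂` handles triple brackets; `γ y ≠ 0` with `y ∈
  -- Y₁` yields the nonzero bracket.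
  obtain ⟨γ, hγy, hγ⟩ := Submodule.exists_dual_map_eq_bot_of_notMem hynC inferInstance
  have hzero (x) (hx : x ∈ C ⊔ Y₂) : γ x = 0 := by
    simpa [hγ] using Submodule.mem_map_of_mem (f := γ) hx
  have hγψ (ψ : T → ℂ) (hψ : ψ ≠ χ) (x) (hx : x ∈ weightSpace T ψ) : γ x = 0 :=
    hzero x (Submodule.mem_sup_left
      (le_iSup₂_of_le (f := fun ψ _ => weightSpace T ψ) ψ hψ le_rfl hx))
  have hγ0 (x) (hx : x ∈ weightSpace T 0) : γ x = 0 := hγψ 0 hχ.symm x hx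
  have hbb (x b v : 𝔤) (hv : v ∈ moved T) : γ ⁅x, ⁅b, v⁆⁆ = 0 := by
    refine moved_induction (p := fun v => γ ⁅x, ⁅b, v⁆⁆ = 0) (by simp)
      (fun x y hx hy => by rw [lie_add, lie_add, map_add, hx, hy, add_zero])
      (fun ψ hψ v hv => ?_) hv
    rcases eq_or_ne ψ χ with rfl | hne
    · exact hzero _ (Submodule.mem_sup_right (Submodule.subset_span
        ⟨x, _, Submodule.subset_span ⟨b, v, hv, rfl⟩, rfl⟩))
    · exact hγψ ψ hne _ (hideal ψ hψ _ _ (hideal ψ hψ _ _ hv))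
  refine ⟨χ, v, γ, hv0, weightSpace_le_moved hχ hvχ, hvχ, hv, fun τ x => ?_, hγ0,
    fun x b c => ?_, ?_⟩
  · have hx : x ∈ ⨆ ψ, weightSpace T ψ := hT.iSup_weightSpace ▸ Submodule.mem_top
    refine Submodule.iSup_induction _ (motive := fun x => γ (τ.1 x) = χ τ * γ x) hx
      (fun ψ x hx => ?_) (by simp)
      (fun x y hx hy => by rw [map_add, map_add, map_add, hx, hy]; ring)
    rcases eq_or_ne ψ χ with rfl | hne
    · rw [mem_weightSpace.1 hx, map_smul, smul_eq_mul]
    · rw [hγψ ψ hne x hx, hγψ ψ hne _ (apply_mem_weightSpace hx τ), mul_zero]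
  · obtain ⟨b, hb, m, hm, rfl⟩ := hT.exists_add b
    obtain ⟨c, hc, n, hn, rfl⟩ := hT.exists_add c
    have h1 : γ ⁅x, ⁅m, c⁆⁆ = 0 := by
      rw [← lie_skew m c, lie_neg, map_neg, hbb x c m hm, neg_zero]
    simp only [add_lie, lie_add, map_add, habel hb hc, lie_zero, map_zero, h1, hbb x _ n hn,
      add_zero]
  · by_contra! h
    refine hγy ((Submodule.span_le (p := LinearMap.ker γ)).2 ?_ hyY)
    rintro _ ⟨x, y, hy, rfl⟩
    obtain ⟨b, hb, m, hm, rfl⟩ := hT.exists_add x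
    have hyV := weightSpace_le_moved hχ hy
    simpa [hM.lie_moved m hm y hyV] using h b hb y hyV

theorem not_isRigid_semiDirectSum (hnil : LieRing.IsNilpotent 𝔤) (hT : IsTorus T)
    (hmet : ∀ a b c d : LieAlgebra.SemiDirectSum 𝔤 T T.incl, ⁅⁅a, b⁆, ⁅c, d⁆⁆ = 0)
    (h0 : weightSpace T 0 ≠ ⊥) (hV : moved T ≠ ⊥) :
    ¬ IsRigid (LieAlgebra.SemiDirectSum 𝔤 T T.incl) := by
  intro hrig
  have hM := isMetabelianAction_of_lie hmet
  obtain ⟨τ₀, hτ₀⟩ := hM.exists_apply_eq_self hnil hT hrig h0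
  have hfaith (k) (hk : k ∈ weightSpace T 0) (hkV : ∀ v ∈ moved T, ⁅k, v⁆ = 0) : k = 0 :=
    hM.eq_zero_of_lie_moved hnil hT hrig hV hτ₀ hk hkV
  have habel {a b : 𝔤} (ha : a ∈ weightSpace T 0) (hb : b ∈ weightSpace T 0) : ⁅a, b⁆ = 0 :=
    hfaith _ (lie_mem_weightSpace ha hb) (hM.lie_lie_moved a b)
  obtain ⟨χ, v, γ, hv0, hvV, hvχ, hv, hγT, hγ0, hγ3, w, hw, u, hu, hwu⟩ :=
    hM.exists_weight_form hnil hT h0 hfaith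
  have hv' (x : 𝔤) : ⁅v, x⁆ = 0 := by rw [← lie_skew, hv, neg_zero]
  let A : weightSpace T 0 →ₗ[ℂ] Module.End ℂ 𝔤 :=
    (LieAlgebra.ad ℂ 𝔤 : 𝔤 →ₗ[ℂ] Module.End ℂ 𝔤) ∘ₗ (weightSpace T 0).subtype
  have hA : Function.Injective A := by
    refine (injective_iff_map_eq_zero _).2 fun a ha => Subtype.ext ?_
    exact hfaith a a.2 fun v _ => LinearMap.congr_fun ha v
  let B : weightSpace T 0 →ₗ[ℂ] Module.End ℂ 𝔤 :=
    (LinearMap.smulRightₗ.flip v ∘ₗ LinearMap.compRight ℂ γ) ∘ₗ A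
  have hB (a : weightSpace T 0) (x : 𝔤) : B a x = γ ⁅a.1, x⁆ • v := rfl
  -- `B a` is a derivation of square zero because `γ` kills triple brackets and `v` is central.
  have hBA (a : weightSpace T 0) : B a ∈ LinearMap.range A := by
    obtain ⟨y, hy, h⟩ := hM.exists_eq_lie hnil hT hrig hV hτ₀ (d := B a)
      (fun x y => by simp [hB, hγ3, hv, hv'])
      (fun τ x => by
        have : ⁅a.1, τ.1 x⁆ = τ.1 ⁅a.1, x⁆ := by
          rw [LieDerivation.apply_lie_eq_add, mem_weightSpace_zero.1 a.2, zero_lie, add_zero]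
        rw [hB, hB, this, hγT, map_smul, mem_weightSpace.1 hvχ, smul_smul, mul_comm])
      (fun x _ => by simp [hB, hv]) (fun x y _ => by simp [hB, hv'])
    exact ⟨⟨y, hy⟩, LinearMap.ext fun x => (h x).symm⟩
  let δ : weightSpace T 0 →ₗ[ℂ] weightSpace T 0 :=
    (LinearEquiv.ofInjective A hA).symm.toLinearMap ∘ₗ B.codRestrict _ hBA
  have hδ (a : weightSpace T 0) (x : 𝔤) : ⁅(δ a).1, x⁆ = γ ⁅a.1, x⁆ • v := by
    have h1 : A (δ a) = B a := congrArg Subtype.val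
      ((LinearEquiv.ofInjective A hA).apply_symm_apply (B.codRestrict _ hBA a))
    exact LinearMap.congr_fun h1 x
  let π : 𝔤 →ₗ[ℂ] weightSpace T 0 := hT.proj.codRestrict _ hT.proj_mem
  let d : 𝔤 →ₗ[ℂ] 𝔤 := (weightSpace T 0).subtype ∘ₗ δ ∘ₗ π + γ.smulRight v
  have hdx (x : 𝔤) : d x = (δ (π x)).1 + γ x • v := rfl
  have hπ {x : 𝔤} (hx : x ∈ moved T) : π x = 0 := Subtype.ext (hT.proj_of_moved hx)
  have hd (x y) : d ⁅x, y⁆ = ⁅d x, y⁆ + ⁅x, d y⁆ := by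
    have h1 : π ⁅x, y⁆ = 0 := Subtype.ext
      ((hM.proj_lie hT x y).trans (habel (hT.proj_mem x) (hT.proj_mem y)))
    have h2 : ⁅x, y⁆ = ⁅hT.proj x, y⁆ - ⁅hT.proj y, x⁆ := by
      have e1 := hM.lie_moved _ (hT.sub_proj_mem x) _ (hT.sub_proj_mem y)
      have e2 := habel (hT.proj_mem x) (hT.proj_mem y)
      rw [sub_lie, lie_sub, lie_sub, e2, sub_zero] at e1
      rw [← lie_skew (hT.proj y) x, sub_neg_eq_add]
      rw [sub_sub, sub_eq_zero] at e1
      rw [e1, add_comm]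
    rw [← lie_skew x (d y), hdx, hdx, hdx, h1, map_zero, add_lie, add_lie, hδ, hδ, smul_lie,
      smul_lie, hv', hv', h2, map_sub, sub_smul]
    change _ = γ ⁅hT.proj x, y⁆ • v + _ + -(γ ⁅hT.proj y, x⁆ • v + _)
    simp [sub_eq_add_neg]
  have hdT (τ : T) (x) : d (τ.1 x) = τ.1 (d x) := by
    rw [hdx, hdx, hπ (hT.apply_mem_moved τ x), map_zero, map_add,
      mem_weightSpace_zero.1 (δ (π x)).2, map_smul, mem_weightSpace.1 hvχ, hγT,
      smul_smul, mul_comm]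
    rfl
  have hτ₀0 : τ₀ ≠ 0 := by
    rintro rfl
    exact hV (eq_bot_iff.2 fun v hv => (hτ₀ v hv).symm)
  obtain ⟨φ, hφ⟩ := Module.Projective.exists_dual_eq_one ℂ hτ₀0
  obtain ⟨t, ht, f, hf⟩ := hrig.exists_semiDirectSum_equiv hT hd hdT (ξ := 0) (by simp) (by simp)
    (by simp) φ
  -- In the deformed law, `τ₀` sends `w` to `t δ(w)` and `u` to `u + t γ(u) v`; these two
  -- commutators have bracket `t γ(⁅w, u⁆) v ≠ 0`.
  have key := hmet (f ⟨0, τ₀⟩) (f ⟨w, 0⟩) (f ⟨0, τ₀⟩) (f ⟨u, 0⟩)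
  rw [← hf, ← hf, ← hf] at key
  have h1 : deformedLie d 0 φ t 0 τ₀ w 0 = t • (δ ⟨w, hw⟩).1 := by
    have : π w = ⟨w, hw⟩ := Subtype.ext (hT.proj_of_fixed hw)
    simp [deformedLie, hφ, hdx, hγ0 w hw, mem_weightSpace_zero.1 hw, this]
  have h2 : deformedLie d 0 φ t 0 τ₀ u 0 = u + (t * γ u) • v := by
    simp [deformedLie, hφ, hdx, hτ₀ u hu, hπ hu, mul_smul]
  have h3 := congrArg (·.left) ((LinearEquiv.map_eq_zero_iff f).1 key)
  rw [h1, h2] at h3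
  simp [deformedLie, hδ, hv, ht, hv0, hwu] at h3

end SemiDirect

end LieRigidity

theorem theorem3 {𝔤 : Type*} [LieRing 𝔤] [LieAlgebra ℂ 𝔤] [FiniteDimensional ℂ 𝔤]
    (hnil : LieRing.IsNilpotent 𝔤) (hnonab : ¬ IsLieAbelian 𝔤)
    (T : LieSubalgebra ℂ (LieDerivation ℂ 𝔤 𝔤)) (hT : LieRigidity.IsTorus T)
    {𝔯 : Type*} [LieRing 𝔯] [LieAlgebra ℂ 𝔯]
    (e : 𝔯 ≃ₗ⁅ℂ⁆ LieAlgebra.SemiDirectSum 𝔤 T T.incl) :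
    ¬ (LieRigidity.IsStepSolvable 𝔯 2 ∧ LieRigidity.IsRigid 𝔯) := by
  rintro ⟨⟨hnn, hder, -⟩, hrig⟩
  have hmet' (a b c d : 𝔯) : ⁅⁅a, b⁆, ⁅c, d⁆⁆ = 0 := by
    have hmem (a b : 𝔯) : ⁅a, b⁆ ∈ LieAlgebra.derivedSeries ℂ 𝔯 1 := by
      rw [LieAlgebra.derivedSeries_def, LieAlgebra.derivedSeriesOfIdeal_succ]
      exact LieSubmodule.lie_mem_lie (LieSubmodule.mem_top a) (LieSubmodule.mem_top b)
    have h : ⁅⁅a, b⁆, ⁅c, d⁆⁆ ∈ LieAlgebra.derivedSeries ℂ 𝔯 2 := by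
      rw [LieAlgebra.derivedSeries_def, LieAlgebra.derivedSeriesOfIdeal_succ]
      exact LieSubmodule.lie_mem_lie (hmem a b) (hmem c d)
    rwa [hder, LieSubmodule.mem_bot] at h
  have hmet (a b c d : LieAlgebra.SemiDirectSum 𝔤 T T.incl) : ⁅⁅a, b⁆, ⁅c, d⁆⁆ = 0 := by
    have h := congrArg e (hmet' (e.symm a) (e.symm b) (e.symm c) (e.symm d))
    simpa only [LieEquiv.map_lie, LieEquiv.apply_symm_apply, map_zero] using h
  have hM := LieRigidity.isMetabelianAction_of_lie hmet
  refine LieRigidity.not_isRigid_semiDirectSum hnil hT hmet (fun h0 => ?_) (fun hV => ?_)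
    (hrig.of_equiv e)
  · have hall (x : 𝔤) : x ∈ LieRigidity.moved T := by
      have := hT.isCompl.sup_eq_top
      rw [h0, bot_sup_eq] at this
      rw [this]
      trivial
    exact hnonab ⟨fun x y => hM.lie_moved x (hall x) y (hall y)⟩
  · have hT0 (τ : T) : τ = 0 := hT.eq_zero_of_apply fun v hv => by
      rw [(Submodule.eq_bot_iff _).1 hV v hv, map_zero]
    have hsurj : Function.Surjective (LieAlgebra.SemiDirectSum.inl T.incl : 𝔤 →ₗ⁅ℂ⁆ _) :=
      fun x => ⟨x.left, LieAlgebra.SemiDirectSum.ext rfl (hT0 _).symm⟩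
    have h1 : LieRing.IsNilpotent (LieAlgebra.SemiDirectSum 𝔤 T T.incl) :=
      hsurj.lieAlgebra_isNilpotent
    exact hnn (e.injective.lieAlgebra_isNilpotent (f := e.toLieHom))
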